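/- Let $F$ be a finite extension of $\mathbb{Q}_p$, let $D$ be a quaternion division algebra with center $F$, and let $E \subset D$ be a maximal subfield, so that $E/F$ is a quadratic extension. Let $\mathrm{SL}_2(D)$ be the group of elements of $\mathrm{GL}_2(D)$ of reduced norm $1$, put $\mathrm{SL}_2^*(E) = \mathrm{SL}_2(D) \cap \mathrm{GL}_2(E)$, and let $N(D) = \left\{ \begin{pmatrix} 1 & x \\ 0 & 1 \end{pmatrix} : x \in D \right\} \cong D$. For a continuous character $\psi : D \to \mathbb{C}^\times$ of the additive group of $D$, a complex representation $\pi$ of $\mathrm{SL}_2(D)$ is called $(N(D),\psi)$-generic if it admits a nonzero $(N(D),\psi)$-degenerate Whittaker functional, i.e. a nonzero linear functional $\ell : \pi \to \mathbb{C}$ with $$\ell\left( \pi \begin{pmatrix} 1 & x \\ 0 & 1 \end{pmatrix} v \right) = \psi(x)\, \ell(v) \qquad \text{for all } v \in \pi,\ x \in D.$$ Let $\pi_\flat$ be an irreducible admissible complex representation of $\mathrm{SL}_2(D)$. Suppose that $\pi_\flat$ is $(N(D),\psi')$-generic for some nontrivial character $\psi'$ of $D$, and that $\pi_\flat$ is $\mathrm{SL}_2^*(E)$-distinguished,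 i.e. there is a nonzero $\mathrm{SL}_2^*(E)$-invariant linear functional $\pi_\flat \to \mathbb{C}$. Then $\pi_\flat$ is $(N(D),\psi)$-generic for some nontrivial character $\psi : D \to \mathbb{C}^\times$ that is trivial on $E$. -/

import Mathlib

open scoped MatrixGroups

namespace QuaternionicSL2

noncomputable section

/-! ### Reduced norm, `SL₂(D)` and its subgroups -/

section Groups

variable (F : Type*) [Field F]

/-- For a central simple `F`-algebra `A` of dimension `n ^ 2`: `c ∈ F` is the reduced norm of `a`,
i.e. `c` is the determinant of the image of `a` under the splittings of `A`
over an algebraic closure `F̄` of `F`. (Every `F`-algebra homomorphism `φ : A → Mₙ(F̄)` induces an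
isomorphism `F̄ ⊗ A ≃ Mₙ(F̄)`; such `φ` exist, and by Skolem–Noether `det (φ a)` is the same for all
of them.) -/
def IsReducedNorm (n : ℕ) {A : Type*} [Ring A] [Algebra F A] (a : A) (c : F) : Prop :=
  ∀ φ : A →ₐ[F] Matrix (Fin n) (Fin n) (AlgebraicClosure F),
    (φ a).det = algebraMap F (AlgebraicClosure F) c

variable (D : Type*) [DivisionRing D] [Algebra F D]

/-- `SL₂(D)`, for a quaternion division algebra `D` over `F`: the elements of `GL₂(D)` of reduced
norm `1`, where `M₂(D)` has dimension `16 = 4 ^ 2` over `F`. As a subgroup of `GL₂(D)`, it carries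
the subspace topology of the unit group of `M₂(D)`. -/
def SL2 : Subgroup (GL (Fin 2) D) where
  carrier := {g | IsReducedNorm F 4 (g : Matrix (Fin 2) (Fin 2) D) 1}
  one_mem' := by
    intro φ
    simp
  mul_mem' := by
    intro g h hg hh φ
    rw [Units.val_mul, map_mul, Matrix.det_mul, hg φ, hh φ]
    simp
  inv_mem' := by
    intro g hg φ
    have h1 : (φ (g : Matrix (Fin 2) (Fin 2) D)).det *
        (φ ((g⁻¹ : GL (Fin 2) D) : Matrix (Fin 2) (Fin 2) D)).det = 1 := by
      rw [← Matrix.det_mul, ← map_mul, ← Units.val_mul]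
      simp
    rw [hg φ] at h1
    simpa using h1

variable {F D}

/-- The subgroup `GL₂(E)` of `GL₂(D)`, for a subalgebra `E` of `D`. -/
def GL2Sub (E : Subalgebra F D) : Subgroup (GL (Fin 2) D) :=
  (Units.map ((E.val : E →+* D).mapMatrix :
    Matrix (Fin 2) (Fin 2) E →+* Matrix (Fin 2) (Fin 2) D).toMonoidHom).range

/-- `SL₂*(E) = SL₂(D) ∩ GL₂(E)`, as a subgroup of `SL₂(D)`. -/
def SL2Star (E : Subalgebra F D) : Subgroup (SL2 F D) :=
  (GL2Sub E).subgroupOf (SL2 F D)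

/-- The upper triangular unipotent matrix with upper right entry `x`, in `GL₂(D)`. -/
def unipGL (x : D) : GL (Fin 2) D where
  val := !![1, x; 0, 1]
  inv := !![1, -x; 0, 1]
  val_inv := by simp [Matrix.one_fin_two]
  inv_val := by simp [Matrix.one_fin_two]

theorem unipGL_mem_SL2 (x : D) : unipGL x ∈ SL2 F D := by
  intro φ
  have h1 : (unipGL x : Matrix (Fin 2) (Fin 2) D) = 1 + !![0, x; 0, 0] * !![0, 0; 0, 1] := by
    simp [unipGL, Matrix.one_fin_two]
  have h2 : (!![0, 0; 0, 1] * !![0, x; 0, 0] : Matrix (Fin 2) (Fin 2) D) = 0 := by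
    ext i j
    fin_cases i <;> fin_cases j <;> simp
  rw [h1, map_add, map_one, map_mul, Matrix.det_one_add_mul_comm, ← map_mul, h2]
  simp

variable (F) in
/-- The element `(1, x; 0, 1)` of `SL₂(D)`; these elements form the subgroup `N(D) ≅ D`. -/
def unip (x : D) : SL2 F D := ⟨unipGL x, unipGL_mem_SL2 x⟩

end Groups

/-! ### Representations -/

section Reps

variable {G V : Type*} [Group G] [TopologicalSpace G] [AddCommGroup V] [Module ℂ V]

/-- Every vector has an open stabilizer. -/
def IsSmooth (π : Representation ℂ G V) : Prop :=
  ∀ v : V, IsOpen {g : G | π g v = v}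

/-- A smooth representation such that the vectors fixed by a compact open subgroup always form a
finite-dimensional space. -/
def IsAdmissible (π : Representation ℂ G V) : Prop :=
  IsSmooth π ∧ ∀ K : Subgroup G, IsOpen (K : Set G) → IsCompact (K : Set G) →
    FiniteDimensional ℂ (Representation.invariants (π.comp K.subtype))

end Reps

section Functionals

variable {V : Type*} [AddCommGroup V] [Module ℂ V]

/-- `π` is distinguished by the subgroup `H`: `Hom_H(π, 𝟙) ≠ 0`. -/
def IsDistinguished {G : Type*} [Group G] (π : Representation ℂ G V) (H : Subgroup G) : Prop :=
  ∃ l : V →ₗ[ℂ] ℂ, l ≠ 0 ∧ ∀ h ∈ H, ∀ v : V, l (π h v) = l v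

variable {F D : Type*} [Field F] [DivisionRing D] [Algebra F D]

/-- `l` is an `(N(D), ψ)`-degenerate Whittaker functional. -/
def IsDegenerateWhittaker (π : Representation ℂ (SL2 F D) V) (ψ : AddChar D ℂ)
    (l : V →ₗ[ℂ] ℂ) : Prop :=
  ∀ (v : V) (x : D), l (π (unip F x) v) = ψ x * l v

/-- `π` is `(N(D), ψ)`-generic: it has a nonzero `(N(D), ψ)`-degenerate Whittaker functional. -/
def IsGeneric (π : Representation ℂ (SL2 F D) V) (ψ : AddChar D ℂ) : Prop :=
  ∃ l : V →ₗ[ℂ] ℂ, l ≠ 0 ∧ IsDegenerateWhittaker π ψ l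

end Functionals

end

end QuaternionicSL2

/-!
Let `ℓ ≠ 0` be an `SL₂*(E)`-invariant functional. If `ℓ` were invariant under the whole of `N(D)`,
it would be invariant under every conjugate of `N(D)` in `SL₂(D)`: by the Bruhat decomposition a
conjugate of a unipotent is obtained from an element of `N(D)` by conjugating with the Weyl element
`w ∈ SL₂*(E)` and with elements of `N(D)` (`apply_conj_unip`). Since `π` is irreducible, a functional
invariant under all conjugates of an element forces that element to act trivially
(`apply_eq_self_of_functional_conj_invariant`), so `N(D)` would act trivially on `π`, against
genericity with respect to a nontrivial character.

So `ℓ` is `N(E)`-invariant but not `N(D)`-invariant, say `ℓ (v₀) ≠ 0` with `v₀ = π(n)w - w`, `n ∈ N(D)`.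
Divide `π` by the largest `N(D)`-stable subspace `W` of `ker ℓ`; then `N(E)` acts trivially on the
quotient, and `v₀` survives in it. The action of `N(D)` is locally torsion: `pⁿ x → 0` in `D` and
stabilizers are open. For a locally torsion action of an abelian group, a stable subspace maximal
among those containing `W` but not `v₀` has a quotient on which the group acts by scalars
(`exists_forall_apply_sub_smul_mem`): two distinct nonzero stable subspaces of the quotient always
meet in the image of `v₀`, which leaves room for one eigenspace only. A functional on this quotient
that does not kill `v₀` is the degenerate Whittaker functional looked for; its character is trivial
on `E`, nontrivial because `v₀ = π(n)w - w`, and continuous because `v₀` has an open stabilizer.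
-/

namespace QuaternionicSL2

/-! ### Locally torsion representations of abelian groups -/

section Torsion

variable {k G V : Type*} [Field k] [CommGroup G] [AddCommGroup V] [Module k V]

/-- A stable subspace avoiding `v₀` is contained in a maximal one. -/
theorem exists_maximal_stable_notMem (ρ : Representation k G V) (W : Submodule k V)
    (hW : ∀ g, W ≤ W.comap (ρ g)) {v₀ : V} (hv₀ : v₀ ∉ W) :
    ∃ M : Submodule k V, W ≤ M ∧ (∀ g, M ≤ M.comap (ρ g)) ∧ v₀ ∉ M ∧
      ∀ M' : Submodule k V, M ≤ M' → (∀ g, M' ≤ M'.comap (ρ g)) → v₀ ∉ M' → M' ≤ M := by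
  obtain ⟨M, hWM, hM⟩ := zorn_le_nonempty₀
    {M : Submodule k V | (∀ g, M ≤ M.comap (ρ g)) ∧ v₀ ∉ M} (fun c hc hchain y hy => by
      have hmem : ∀ z, z ∈ sSup c ↔ ∃ N ∈ c, z ∈ N := fun z =>
        Submodule.mem_sSup_of_directed ⟨y, hy⟩ hchain.directedOn
      refine ⟨sSup c, ⟨fun g z hz => ?_, fun h => ?_⟩, fun z hz => le_sSup hz⟩
      · obtain ⟨N, hN, hzN⟩ := (hmem z).1 hz
        exact (hmem _).2 ⟨N, hN, (hc hN).1 g hzN⟩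
      · obtain ⟨N, hN, hzN⟩ := (hmem v₀).1 h
        exact (hc hN).2 hzN) W ⟨hW, hv₀⟩
  exact ⟨M, hWM, hM.prop.1, hM.prop.2, fun M' h1 h2 h3 => hM.le_of_ge ⟨h2, h3⟩ h1⟩

/-- If a product of factors `f - c` sends a vector outside `M` into `M`, then one of the factors
sends some vector outside `M` into `M`. -/
theorem exists_apply_sub_smul_mem_of_aeval_mem (f : Module.End k V) (M : Submodule k V)
    {v : V} (hv : v ∉ M) (s : Multiset k)
    (hs : Polynomial.aeval f (s.map fun c => Polynomial.X - Polynomial.C c).prod v ∈ M) :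
    ∃ c : k, ∃ w ∉ M, f w - c • w ∈ M := by
  induction s using Multiset.induction with
  | empty => simp [hv] at hs
  | cons c s ih =>
    by_cases h : Polynomial.aeval f (s.map fun c => Polynomial.X - Polynomial.C c).prod v ∈ M
    · exact ih h
    · refine ⟨c, _, h, ?_⟩
      simpa [Module.algebraMap_end_apply] using hs

variable [IsAlgClosed k] [CharZero k]

/-- Let `M` be maximal among the stable subspaces not containing `v₀`. If the action is locally
torsion, then each group element acts on `V ⧸ M` by a scalar. -/
theorem exists_forall_apply_sub_smul_mem (ρ : Representation k G V)
    (hρ : ∀ (g : G) (v : V), ∃ n : ℕ, 0 < n ∧ (ρ g ^ n) v = v)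
    (M : Submodule k V) (hM : ∀ g, M ≤ M.comap (ρ g)) {v₀ : V} (hv₀ : v₀ ∉ M)
    (hmax : ∀ M' : Submodule k V, M ≤ M' → (∀ g, M' ≤ M'.comap (ρ g)) → v₀ ∉ M' → M' ≤ M)
    (g : G) : ∃ c : k, ∀ v, ρ g v - c • v ∈ M := by
  -- The preimage of `M` under an operator commuting with the action is either `M` or contains `v₀`.
  have key : ∀ T : Module.End k V, (∀ h, Commute T (ρ h)) → (∀ m ∈ M, T m ∈ M) →
      (∃ w ∉ M, T w ∈ M) → T v₀ ∈ M := by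
    intro T hT hTM ⟨w, hw, hTw⟩
    by_contra hcon
    refine hw (hmax (M.comap T) hTM (fun h z hz => ?_) hcon hTw)
    change T (ρ h z) ∈ M
    have := LinearMap.congr_fun (hT h).eq z
    simp only [Module.End.mul_apply] at this
    rw [this]
    exact hM h hz
  have hcomm : ∀ h, Commute (ρ g) (ρ h) := fun h => by
    rw [commute_iff_eq, ← map_mul, ← map_mul, mul_comm]
  have hpow : ∀ (i : ℕ), ∀ m ∈ M, (ρ g ^ i) m ∈ M := by
    intro i m hm
    rw [← map_pow]
    exact hM _ hm
  obtain ⟨c, hc⟩ : ∃ c : k, ρ g v₀ - c • v₀ ∈ M := by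
    obtain ⟨n, hn, hgn⟩ := hρ g v₀
    have hsplit := (IsAlgClosed.splits (Polynomial.X ^ n - 1 : Polynomial k))
    have hmonic : (Polynomial.X ^ n - 1 : Polynomial k).Monic :=
      Polynomial.monic_X_pow_sub_C 1 hn.ne'
    obtain ⟨c, w, hw, hcw⟩ := exists_apply_sub_smul_mem_of_aeval_mem (ρ g) M hv₀
      (Polynomial.X ^ n - 1 : Polynomial k).roots (by
        rw [← hsplit.eq_prod_roots_of_monic hmonic]
        simp [hgn])
    refine ⟨c, ?_⟩
    have := key (ρ g - algebraMap k _ c)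
      (fun h => (hcomm h).sub_left (Algebra.commutes c _))
      (fun m hm => by
        simpa [Module.algebraMap_end_apply] using M.sub_mem (hM g hm) (M.smul_mem c hm))
      ⟨w, hw, by simpa [Module.algebraMap_end_apply] using hcw⟩
    simpa [Module.algebraMap_end_apply] using this
  refine ⟨c, fun v => ?_⟩
  have hci : ∀ i : ℕ, (ρ g ^ i) v₀ - c ^ i • v₀ ∈ M := by
    intro i
    induction i with
    | zero => simp
    | succ i ih =>
      have h1 := M.add_mem (hM g ih) (M.smul_mem (c ^ i) hc)
      have h2 : (ρ g ^ (i + 1)) v₀ - c ^ (i + 1) • v₀ =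
          ρ g ((ρ g ^ i) v₀ - c ^ i • v₀) + c ^ i • (ρ g v₀ - c • v₀) := by
        rw [pow_succ', Module.End.mul_apply, map_sub, map_smul, smul_sub, smul_smul, ← pow_succ]
        abel
      rw [h2]
      exact h1
  obtain ⟨a, ha, hga⟩ := hρ g v₀
  obtain ⟨b, hb, hgb⟩ := hρ g v
  have hv₀n : (ρ g ^ (a * b)) v₀ = v₀ := by
    rw [pow_mul, Module.End.pow_apply]
    exact Function.IsFixedPt.iterate hga b
  have hvn : (ρ g ^ (a * b)) v = v := by
    rw [mul_comm, pow_mul, Module.End.pow_apply]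
    exact Function.IsFixedPt.iterate hgb a
  set n := a * b with hn
  have hnpos : n ≠ 0 := by positivity
  have hcn : c ^ n = 1 := by
    by_contra hne
    have h1 := hci n
    rw [hv₀n] at h1
    have h2 : (1 - c ^ n) • v₀ ∈ M := by rwa [sub_smul, one_smul]
    exact hv₀ ((M.smul_mem_iff (sub_ne_zero.2 (Ne.symm hne))).1 h2)
  have hc0 : c ≠ 0 := by
    rintro rfl
    simp [hnpos] at hcn
  -- `Φ` is, up to a scalar, the projector onto the `c`-eigenspace of `ρ g` on vectors fixed by
  -- `ρ g ^ n`. It kills `(ρ g - c) v`, but does not send `v₀` into `M`.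
  set Φ : Module.End k V :=
    ∑ i ∈ Finset.range n, ρ g ^ i * (algebraMap k (Module.End k V) c) ^ (n - 1 - i) with hΦ
  have hΦapply : ∀ w, Φ w = ∑ i ∈ Finset.range n, c ^ (n - 1 - i) • (ρ g ^ i) w := by
    intro w
    simp only [hΦ, LinearMap.sum_apply]
    refine Finset.sum_congr rfl fun i _ => ?_
    rw [← map_pow (algebraMap k (Module.End k V)), Module.End.mul_apply,
      Module.algebraMap_end_apply, map_smul]
  have hΦkill : Φ (ρ g v - c • v) = 0 := by
    have h1 : Commute (ρ g) (algebraMap k (Module.End k V) c) := (Algebra.commutes c _).symm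
    have h2 := LinearMap.congr_fun (h1.geom_sum₂_mul n) v
    rw [Module.End.mul_apply, ← map_pow (algebraMap k (Module.End k V)), hcn] at h2
    simpa [Module.algebraMap_end_apply, hvn, hΦ] using h2
  by_contra hcon
  have h3 := key Φ
    (fun h => Commute.sum_left _ _ _ fun i _ =>
      ((hcomm h).pow_left i).mul_left (Commute.pow_left (Algebra.commutes c (ρ h)) _))
    (fun m hm => by
      rw [hΦapply]
      exact M.sum_mem fun i _ => M.smul_mem _ (hpow i m hm))
    ⟨_, hcon, by rw [hΦkill]; exact M.zero_mem⟩
  have h4 : Φ v₀ - ((n : k) * c ^ (n - 1)) • v₀ ∈ M := by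
    have h5 : Φ v₀ - ((n : k) * c ^ (n - 1)) • v₀ =
        ∑ i ∈ Finset.range n, c ^ (n - 1 - i) • ((ρ g ^ i) v₀ - c ^ i • v₀) := by
      rw [hΦapply]
      simp only [smul_sub, Finset.sum_sub_distrib]
      congr 1
      rw [Finset.sum_congr rfl (g := fun _ => c ^ (n - 1) • v₀)]
      · simp [mul_smul, Nat.cast_smul_eq_nsmul]
      · intro i hi
        rw [smul_smul, ← pow_add, Nat.sub_add_cancel]
        have := Finset.mem_range.1 hi
        omega
    rw [h5]
    exact M.sum_mem fun i _ => M.smul_mem _ (hci i)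
  have h6 := M.sub_mem h3 h4
  rw [sub_sub_cancel] at h6
  exact hv₀ ((M.smul_mem_iff (mul_ne_zero (Nat.cast_ne_zero.2 hnpos) (pow_ne_zero _ hc0))).1 h6)

/-- A vector outside a stable subspace `W` of a locally torsion representation of an abelian group
is detected by an eigenfunctional that vanishes on `W`. -/
theorem exists_eigenfunctional (ρ : Representation k G V)
    (hρ : ∀ (g : G) (v : V), ∃ n : ℕ, 0 < n ∧ (ρ g ^ n) v = v)
    (W : Submodule k V) (hW : ∀ g, W ≤ W.comap (ρ g)) {v₀ : V} (hv₀ : v₀ ∉ W) :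
    ∃ (χ : G →* k) (l : V →ₗ[k] k), l v₀ ≠ 0 ∧ (∀ w ∈ W, l w = 0) ∧
      ∀ g v, l (ρ g v) = χ g * l v := by
  obtain ⟨M, hWM, hM, hvM, hmax⟩ := exists_maximal_stable_notMem ρ W hW hv₀
  choose c hc using exists_forall_apply_sub_smul_mem ρ hρ M hM hvM hmax
  obtain ⟨l, hl, hlM⟩ := Submodule.exists_le_ker_of_notMem hvM
  have hlc : ∀ g v, l (ρ g v) = c g * l v := by
    intro g v
    have := hlM (hc g v)
    rw [LinearMap.mem_ker, map_sub, map_smul, smul_eq_mul, sub_eq_zero] at this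
    exact this
  refine ⟨⟨⟨c, ?_⟩, fun g h => ?_⟩, l, hl, fun w hw => hlM (hWM hw), hlc⟩
  · have := hlc 1 v₀
    rw [map_one, Module.End.one_apply] at this
    exact mul_right_cancel₀ hl (by rw [one_mul]; exact this.symm)
  · have := hlc (g * h) v₀
    rw [map_mul, Module.End.mul_apply, hlc, hlc, ← mul_assoc] at this
    exact mul_right_cancel₀ hl this.symm

end Torsion

/-! ### Functionals invariant under the conjugates of an element -/

theorem apply_eq_self_of_functional_conj_invariant {G V : Type*} [Group G] [AddCommGroup V]
    [Module ℂ V] (π : Representation ℂ G V) (hirr : π.IsIrreducible) {l : V →ₗ[ℂ] ℂ} (hl : l ≠ 0)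
    {u : G} (hu : ∀ g v, l (π (g * u * g⁻¹) v) = l v) (v : V) : π u v = v := by
  -- the largest subrepresentation contained in the kernel of `l`
  let K : Subrepresentation π :=
    { toSubmodule := ⨅ g, LinearMap.ker (l ∘ₗ π g)
      apply_mem_toSubmodule := by
        intro g v hv
        simp only [Submodule.mem_iInf, LinearMap.mem_ker, LinearMap.comp_apply] at hv ⊢
        intro h
        simpa [map_mul] using hv (h * g) }
  have hK : ∀ v, v ∈ K.toSubmodule ↔ ∀ g, l (π g v) = 0 := by
    intro v
    simp [K, Submodule.mem_iInf]
  have hbot : K = ⊥ := by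
    refine (hirr.eq_bot_or_eq_top K).resolve_right fun htop => hl ?_
    ext v
    have hv : v ∈ K.toSubmodule := by
      rw [htop]
      exact Submodule.mem_top
    simpa using (hK v).1 hv 1
  have hmem : π u v - v ∈ K.toSubmodule := by
    rw [hK]
    intro g
    have := hu g (π g v)
    rw [← Module.End.mul_apply, ← map_mul, inv_mul_cancel_right, map_mul,
      Module.End.mul_apply] at this
    rw [map_sub, map_sub, this, sub_self]
  rw [hbot] at hmem
  exact sub_eq_zero.1 ((Submodule.mem_bot ℂ).1 hmem)

/-! ### Unipotents and the Weyl element in `SL₂(D)` -/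

section Group

variable {F D : Type*} [Field F] [DivisionRing D] [Algebra F D]

variable (F D) in
/-- The isomorphism `D ≅ N(D)`, as a homomorphism into `SL₂(D)`. -/
def unipHom : Multiplicative D →* SL2 F D where
  toFun x := unip F x.toAdd
  map_one' := by
    ext i j
    fin_cases i <;> fin_cases j <;> simp [unip, unipGL]
  map_mul' x y := by
    ext i j
    fin_cases i <;> fin_cases j <;> simp [unip, unipGL, add_comm]

variable (D) in
/-- The Weyl element `(0, 1; -1, 0)` of `GL₂(D)`. -/
def weylGL : GL (Fin 2) D where
  val := !![0, 1; -1, 0]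
  inv := !![0, -1; 1, 0]
  val_inv := by simp [Matrix.one_fin_two]
  inv_val := by simp [Matrix.one_fin_two]

theorem weylGL_mem_SL2 : weylGL D ∈ SL2 F D := by
  intro φ
  -- `w = u * l * u` with `u` upper and `l` lower triangular unipotent
  have h1 : (weylGL D : Matrix (Fin 2) (Fin 2) D) = (unipGL (1 : D) : Matrix (Fin 2) (Fin 2) D) *
      (1 + !![0, 0; -1, 0] * !![1, 0; 0, 0]) * (unipGL (1 : D) : Matrix (Fin 2) (Fin 2) D) := by
    simp [weylGL, unipGL, Matrix.one_fin_two]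
  have h2 : (!![1, 0; 0, 0] * !![0, 0; -1, 0] : Matrix (Fin 2) (Fin 2) D) = 0 := by
    ext i j
    fin_cases i <;> fin_cases j <;> simp
  have h3 := unipGL_mem_SL2 (F := F) (1 : D) φ
  rw [h1, map_mul, map_mul, Matrix.det_mul, Matrix.det_mul, h3, map_add, map_one φ, map_mul,
    Matrix.det_one_add_mul_comm, ← map_mul, h2]
  simp

variable (F D) in
/-- The Weyl element `(0, 1; -1, 0)` of `SL₂(D)`. -/
def weyl : SL2 F D := ⟨weylGL D, weylGL_mem_SL2⟩

theorem weyl_mem_SL2Star (E : Subalgebra F D) : weyl F D ∈ SL2Star E := by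
  rw [SL2Star, Subgroup.mem_subgroupOf]
  refine ⟨⟨!![0, 1; -1, 0], !![0, -1; 1, 0], by simp [Matrix.one_fin_two],
    by simp [Matrix.one_fin_two]⟩, ?_⟩
  ext i j
  fin_cases i <;> fin_cases j <;> simp [weyl, weylGL]

theorem unip_mem_SL2Star (E : Subalgebra F D) {e : D} (he : e ∈ E) : unip F e ∈ SL2Star E := by
  rw [SL2Star, Subgroup.mem_subgroupOf]
  refine ⟨⟨!![1, ⟨e, he⟩; 0, 1], !![1, -⟨e, he⟩; 0, 1], by simp [Matrix.one_fin_two],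
    by simp [Matrix.one_fin_two]⟩, ?_⟩
  ext i j
  fin_cases i <;> fin_cases j <;> simp [unip, unipGL]

/-- Upper triangular matrices normalize `N(D)`. -/
theorem exists_conj_unip_of_lower_left_eq_zero (g : SL2 F D)
    (hg : (g : GL (Fin 2) D).val 1 0 = 0) (x : D) : ∃ y, g * unip F x * g⁻¹ = unip F y := by
  set A := (g : GL (Fin 2) D).val with hA
  set B := ((g⁻¹ : SL2 F D) : GL (Fin 2) D).val with hB
  have hAB : A * B = 1 := by
    rw [hA, hB, ← Units.val_mul, ← Subgroup.coe_mul]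
    simp
  have h11 : A 1 1 * B 1 1 = 1 := by
    have := congrFun (congrFun hAB 1) 1
    simpa [Matrix.mul_apply, hg] using this
  refine ⟨A 0 0 * x * (A 1 1)⁻¹, ?_⟩
  rw [mul_inv_eq_iff_eq_mul]
  have hne : A 1 1 ≠ 0 := left_ne_zero_of_mul_eq_one h11
  ext i j
  fin_cases i <;> fin_cases j <;>
    simp [unip, unipGL, Matrix.mul_apply, hg, ← hA, mul_assoc, hne, add_comm]

/-- A functional invariant under `N(D)` and the Weyl element is invariant under all conjugates of
`N(D)`: by the Bruhat decomposition it suffices to conjugate by `N(D)` and the Weyl element. -/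
theorem apply_conj_unip {V : Type*} [AddCommGroup V] [Module ℂ V]
    (π : Representation ℂ (SL2 F D) V) {l : V →ₗ[ℂ] ℂ}
    (hN : ∀ x v, l (π (unip F x) v) = l v) (hw : ∀ v, l (π (weyl F D) v) = l v)
    (x : D) (g : SL2 F D) (v : V) : l (π (g * unip F x * g⁻¹) v) = l v := by
  let S : Subgroup (SL2 F D) :=
    { carrier := {g | ∀ v, l (π g v) = l v}
      one_mem' := by simp
      mul_mem' := by
        intro a b ha hb v
        rw [map_mul, Module.End.mul_apply, ha, hb]
      inv_mem' := by
        intro a ha v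
        rw [← ha, ← Module.End.mul_apply, ← map_mul, mul_inv_cancel, map_one,
          Module.End.one_apply] }
  suffices h : g * unip F x * g⁻¹ ∈ S from h v
  have hNS : ∀ x, unip F x ∈ S := hN
  by_cases hc : (g : GL (Fin 2) D).val 1 0 = 0
  · obtain ⟨y, hy⟩ := exists_conj_unip_of_lower_left_eq_zero g hc x
    rw [hy]
    exact hNS y
  · set y := (g : GL (Fin 2) D).val 0 0 * ((g : GL (Fin 2) D).val 1 0)⁻¹ with hy
    have hs : unip F y * weyl F D ∈ S := S.mul_mem (hNS y) hw
    set s := unip F y * weyl F D with hsdef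
    -- `s⁻¹ * g` is upper triangular
    obtain ⟨z, hz⟩ := exists_conj_unip_of_lower_left_eq_zero (s⁻¹ * g) (by
      have h1 : ((s⁻¹ : SL2 F D) : GL (Fin 2) D).val =
          !![0, -1; 1, 0] * !![1, -y; 0, 1] := by
        rw [hsdef, mul_inv_rev]
        rfl
      rw [Subgroup.coe_mul, Units.val_mul, h1]
      simp [Matrix.mul_apply, Fin.sum_univ_two, hy, hc]) x
    have h2 : g * unip F x * g⁻¹ = s * unip F z * s⁻¹ := by
      rw [← hz]
      group
    rw [h2]
    exact S.mul_mem (S.mul_mem hs (hNS z)) (S.inv_mem hs)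

end Group

/-! ### Topology of `N(D)` -/

section Topology

theorem continuous_unip (F : Type*) {D : Type*} [Field F] [DivisionRing D] [Algebra F D]
    [TopologicalSpace D] [ContinuousNeg D] : Continuous (unip F : D → SL2 F D) := by
  refine Continuous.subtype_mk (Units.continuous_iff.2 ⟨?_, ?_⟩) _
  · change Continuous fun x : D => !![1, x; 0, 1]
    refine continuous_matrix fun i j => ?_
    fin_cases i <;> fin_cases j <;> simp [continuous_const, continuous_id']
  · change Continuous fun x : D => !![1, -x; 0, 1]
    refine continuous_matrix fun i j => ?_
    fin_cases i <;> fin_cases j <;> simp [continuous_const, continuous_neg]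

theorem tendsto_pow_prime_smul (p : ℕ) [Fact p.Prime] {F : Type*} [Field F] [Algebra ℚ_[p] F]
    [TopologicalSpace F] [ContinuousSMul ℚ_[p] F] {D : Type*} [AddCommGroup D] [Module F D]
    [TopologicalSpace D] [ContinuousSMul F D] (x : D) :
    Filter.Tendsto (fun n : ℕ => (p ^ n) • x) Filter.atTop (nhds 0) := by
  have h1 : Filter.Tendsto (fun n : ℕ => (p : ℚ_[p]) ^ n) Filter.atTop (nhds 0) :=
    tendsto_pow_atTop_nhds_zero_of_norm_lt_one Padic.norm_p_lt_one
  have h2 : Continuous fun c : ℚ_[p] => (c • (1 : F)) • x := by fun_prop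
  have h3 := (h2.tendsto 0).comp h1
  simp only [zero_smul] at h3
  refine h3.congr fun n => ?_
  rw [Function.comp_apply, ← Nat.cast_pow, Nat.cast_smul_eq_nsmul, smul_assoc, one_smul]

end Topology

end QuaternionicSL2

open QuaternionicSL2 in
theorem proposition4p8
    -- `F` is a finite extension of `ℚ_p`, with its topology
    {p : ℕ} [Fact p.Prime]
    {F : Type*} [Field F] [Algebra ℚ_[p] F] [FiniteDimensional ℚ_[p] F]
    [TopologicalSpace F] [IsModuleTopology ℚ_[p] F]
    -- `D` is a quaternion division algebra over `F`, with its topology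
    {D : Type*} [DivisionRing D] [Algebra F D] [Algebra.IsCentral F D]
    (hD : Module.finrank F D = 4)
    [TopologicalSpace D] [IsModuleTopology F D]
    -- `E` is a maximal subfield of `D`, so that `E / F` is quadratic
    (E : Subalgebra F D) (hEfield : IsField E) (hE : Module.finrank F E = 2)
    -- `π` is an irreducible admissible representation of `SL₂(D)`
    {V : Type*} [AddCommGroup V] [Module ℂ V]
    (π : Representation ℂ (QuaternionicSL2.SL2 F D) V)
    (hirr : π.IsIrreducible) (hadm : QuaternionicSL2.IsAdmissible π)
    (hgen : ∃ ψ : AddChar D ℂ, Continuous ψ ∧ ψ ≠ 1 ∧ QuaternionicSL2.IsGeneric π ψ)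
    (hdist : QuaternionicSL2.IsDistinguished π (QuaternionicSL2.SL2Star E)) :
    ∃ ψ : AddChar D ℂ, Continuous ψ ∧ ψ ≠ 1 ∧ (∀ e ∈ E, ψ e = 1) ∧
      QuaternionicSL2.IsGeneric π ψ := by
  have : ContinuousAdd D := IsModuleTopology.toContinuousAdd F D
  have : ContinuousNeg D := IsModuleTopology.continuousNeg F D
  obtain ⟨ψ', -, hψ', l', hl', hW'⟩ := hgen
  obtain ⟨l, hl, hinv⟩ := hdist
  -- `l` is not invariant under the whole of `N(D)`
  obtain ⟨x₀, w₀, hx₀⟩ : ∃ x w, l (π (unip F x) w) ≠ l w := by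
    by_contra! hN
    apply hψ'
    ext x
    obtain ⟨v, hv⟩ := DFunLike.ne_iff.1 hl'
    have h1 := hW' v x
    rw [apply_eq_self_of_functional_conj_invariant π hirr hl
      (apply_conj_unip π hN (hinv _ (weyl_mem_SL2Star E)) x) v] at h1
    exact mul_right_cancel₀ hv (by rw [AddChar.one_apply, one_mul]; exact h1.symm)
  let ρ : Representation ℂ (Multiplicative D) V := π.comp (unipHom F D)
  have hρ_apply : ∀ x : D, ρ (Multiplicative.ofAdd x) = π (unip F x) := fun _ => rfl
  have hopen : ∀ v : V, IsOpen {x : D | ρ (Multiplicative.ofAdd x) v = v} := fun v =>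
    (hadm.1 v).preimage (continuous_unip F)
  have htors : ∀ (g : Multiplicative D) (v : V), ∃ n : ℕ, 0 < n ∧ (ρ g ^ n) v = v := by
    intro g v
    have h1 := (tendsto_pow_prime_smul p (F := F) g.toAdd).eventually
      ((hopen v).mem_nhds (by simp))
    obtain ⟨n, hn⟩ := h1.exists
    refine ⟨p ^ n, pow_pos (Fact.out : p.Prime).pos n, ?_⟩
    rw [← map_pow]
    exact hn
  -- the largest `N(D)`-stable subspace of the kernel of `l`
  let W : Submodule ℂ V := ⨅ g, LinearMap.ker (l ∘ₗ ρ g)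
  have hWmem : ∀ v, v ∈ W ↔ ∀ g, l (ρ g v) = 0 := by
    intro v
    simp [W, Submodule.mem_iInf]
  have hWstab : ∀ g, W ≤ W.comap (ρ g) := by
    intro g v hv
    rw [Submodule.mem_comap, hWmem]
    intro h
    rw [← Module.End.mul_apply, ← map_mul]
    exact (hWmem v).1 hv _
  have hv₀ : π (unip F x₀) w₀ - w₀ ∉ W := by
    intro h
    have h1 := (hWmem _).1 h 1
    rw [map_one, Module.End.one_apply, map_sub] at h1
    exact hx₀ (sub_eq_zero.1 h1)
  obtain ⟨χ, L, hL, hLW, hχ⟩ := exists_eigenfunctional ρ htors W hWstab hv₀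
  have hfix : ∀ x v, L v ≠ 0 → L (ρ (Multiplicative.ofAdd x) v) = L v →
      χ (Multiplicative.ofAdd x) = 1 := by
    intro x v hv h
    rw [hχ] at h
    exact mul_right_cancel₀ hv (by rw [one_mul]; exact h)
  refine ⟨AddChar.toMonoidHomEquiv.symm χ, ?_, ?_, ?_, L, ?_, ?_⟩
  · -- `χ` is trivial on the stabilizer of a vector, hence locally constant
    refine IsLocallyConstant.continuous ((IsLocallyConstant.iff_eventually_eq _).2 fun x => ?_)
    have h1 : Filter.Tendsto (fun y : D => y + -x) (nhds x) (nhds 0) := by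
      have : Continuous fun y : D => y + -x := by fun_prop
      simpa using this.tendsto x
    filter_upwards [h1.eventually ((hopen (π (unip F x₀) w₀ - w₀)).mem_nhds (by simp))] with y hy
    have h2 := hfix _ _ hL (congrArg L hy)
    have h3 : χ (Multiplicative.ofAdd (y + -x)) * χ (Multiplicative.ofAdd x) =
        χ (Multiplicative.ofAdd y) := by
      rw [← map_mul, ← ofAdd_add, neg_add_cancel_right]
    rw [h2, one_mul] at h3
    exact h3.symm
  · intro h
    have h1 : χ (Multiplicative.ofAdd x₀) = 1 := DFunLike.congr_fun h x₀
    apply hL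
    rw [map_sub, ← hρ_apply, hχ, h1, one_mul, sub_self]
  · intro e he
    -- `N(E)` acts trivially modulo `W`, as `N(D)` is commutative
    have h1 : ∀ v, ρ (Multiplicative.ofAdd e) v - v ∈ W := by
      intro v
      rw [hWmem]
      intro g
      rw [map_sub, ← Module.End.mul_apply, ← map_mul, mul_comm, map_mul, Module.End.mul_apply,
        map_sub, hρ_apply, hinv _ (unip_mem_SL2Star E he), sub_self]
    refine hfix e _ hL ?_
    have h2 := hLW _ (h1 (π (unip F x₀) w₀ - w₀))
    rwa [map_sub, sub_eq_zero] at h2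
  · rintro rfl
    exact hL rfl
  · intro v x
    exact hχ _ v
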